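/- **Agreement on the global model.** Let $N>3f+2$. Consider one iteration of the protocol described below among participants $P_1,\dots,P_N$ on a synchronous point-to-point network, at most $f$ of which are Byzantine; the others, called benign, follow the protocol, with arbitrary local models $w_i\in\mathbb Z_q^m$ ($\mathbb Z_q$ is the set of non-negative integers at most $q$) and arbitrary private randomness in $\mathbb Z_q^m$. Byzantine participants may send arbitrary, mutually inconsistent messages, or none. All benign participants then compute the same global model $w$: in every coordinate $k\in[m]$ either all of them obtain the same value $w^k$, or for all of them the verification fails and $w^k$ is not computed. This holds when the broadcasts are carried out by the Lamport–Shostak–Pease oral messages algorithm $OM(f)$, and, more generally, when they are carried out by any BFT broadcast, i.e. any broadcast primitive which for $N>3f$ and at most $f$ Byzantine participants always terminates, delivers the same message to all benign participants, and delivers to them the message sent if the sender is benign. *Protocol.* Public parameters are a group of prime order $q$ with generators $g,h$, a prime $\beta$, and a deterministic topological sorting procedure common to all participants. The commitment is $\mathcal C(w,r)=g^wh^r$, coordinate-wise. 1. $P_i$ broadcasts $\mathcal W_i=\mathcal C(w_i,r^w_i)$. 2. For $j\ne i$, $P_i$ sends $P_j$ the commitment $\mathcal V_{ij}=\mathcal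 C(v_{ij},r^v_{ij})$, the vectors $c_{ij}=w_i+v_{ij}$ and $r^{w+v}_{ij}=r^w_i+r^v_{ij}$, and random vectors $s^1_{ij},r^{s1}_{ij},s^2_{ij},r^{s2}_{ij}$. If $\mathcal W_j\mathcal V_{ji}=\mathcal C(c_{ji},r^{w+v}_{ji})$, then $P_i$ sends $m_{ij}=[d_{ij},r^d_{ij},\mathcal V_{ij},\mathcal V_{ji}]$, with $d_{ij}=v_{ij}+c_{ji}$ and $r^d_{ij}=r^v_{ij}+r^{w+v}_{ji}$, to everybody but $P_j$. For every pair $p,p'$ different from $i$, if $P_i$ has received $m_{pp'}$ and $m_{p'p}$, they agree on $\mathcal V_{pp'}$ and $\mathcal V_{p'p}$, and $\mathcal C(d_{pp'},r^d_{pp'})=\mathcal V_{pp'}\mathcal V_{p'p}\mathcal W_{p'}$ and $\mathcal C(d_{p'p},r^d_{p'p})=\mathcal V_{p'p}\mathcal V_{pp'}\mathcal W_p$, then $P_i$ broadcasts for each $k$ the relation ($<$ or $>$, ties broken arbitrarily) between $w_p^k$ and $w_{p'}^k$, read off from $d_{p'p}^k$ and $d_{pp'}^k$. 3. $P_i$ accepts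 a relation in coordinate $k$ if more than $2f$ participants broadcast it, sorts the participants topologically in ascending order by the accepted relations into a list $\mathcal S_i^k$ of length $N_i^k$, and takes as contributors $\mathbb C_i^k$ its $(f+1)$-th to $(N_i^k-f)$-th entries. 4. Put $a_{ij}=s^1_{ij}+s^1_{ji}$ and $b_{ij}=s^2_{ij}+s^2_{ji}$ (missing vectors count as $0$). $P_i$ broadcasts the commitments $\mathcal C(a_{ij},r^{s1}_{ij}+r^{s1}_{ji})$ and $\mathcal C(b_{ij},r^{s2}_{ij}+r^{s2}_{ji})$ for $j\neq i$ and, for each $k$ with $P_i\in\mathbb C_i^k$, the cloaked values $\bar w_i^k=(w_i^k-\sum_{j}a_{ij}^k+\sum_{j'}a_{ij'}^k)\bmod\beta$ and $\bar r_i^k=(r_i^{w,k}-\sum_{j}b_{ij}^k+\sum_{j'}b_{ij'}^k)\bmod\beta$, where $j$ and $j'$ run over the contributors below, respectively above, $P_i$ in $\mathcal S_i^k$. From the delivered values $P_i$ computes $\bar w^k=\sum_{P_j\in\mathbb C_i^k}\bar w_j^k\bmod\beta$ and $\bar r^k=\sum_{P_j\in\mathbb C_i^k}\bar r_j^k\bmod\beta$.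 If $N_i^k>2f$, no required value is missing and $\mathcal C(\bar w^k,\bar r^k)=\prod_{P_j\in\mathbb C_i^k}\mathcal W_j^k$, it sets $w^k=\bar w^k/(N_i^k-2f)$; otherwise the verification fails. -/

import Mathlib

/-! ## Byzantine fault tolerant broadcast -/

/-- A broadcast primitive among the participants `Fin N`, given by its possible outcomes:
`B M byz s x out` says that, when the participants in `byz` are Byzantine (and deviate in some way)
and participant `s` broadcasts `x`, participant `i` may end up with `out i`.
`none` stands for "no message". -/
abbrev BroadcastSystem (N : ℕ) : Type 1 :=
  (M : Type) → Finset (Fin N) → Fin N → Option M → (Fin N → Option M) → Prop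

/-- The Byzantine broadcast (Byzantine generals) specification with resilience `f < N / 3`:
if `N > 3 f` and at most `f` participants are Byzantine, then the broadcast terminates, all benign
participants obtain the same message, and this is the message that was sent if the sender is
benign. -/
def IsBFTBroadcast {N : ℕ} (f : ℕ) (B : BroadcastSystem N) : Prop :=
  3 * f < N → ∀ (M : Type) (byz : Finset (Fin N)), byz.card ≤ f → ∀ (s : Fin N) (x : Option M),
    (∃ out, B M byz s x out) ∧
    ∀ out, B M byz s x out →
      (∀ i ∉ byz, ∀ j ∉ byz, out i = out j) ∧ (s ∉ byz → ∀ i ∉ byz, out i = x)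

open scoped Classical in
/-- The strict majority value of `val` on `L`; "no message" if there is none. -/
noncomputable def majorityVote {N : ℕ} {M : Type} (L : Finset (Fin N)) (val : Fin N → Option M) :
    Option M :=
  if h : ∃ x, L.card < 2 * (L.filter fun j => val j = x).card then h.choose else none

/-- The oral messages algorithm `OM(k)` of Lamport, Shostak and Pease for unauthenticated messages
on a synchronous network. `omValue byz adv k L path c v i` is the value on which lieutenant `i ∈ L`
settles when commander `c` sends `v` to the lieutenants `L`. A Byzantine `c` instead sends
`adv path c j` to each lieutenant `j`; here `path` lists the commanders of the enclosing recursive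
calls, so `adv` is an arbitrary choice for every single message of every Byzantine participant. -/
noncomputable def omValue {N : ℕ} {M : Type} (byz : Finset (Fin N))
    (adv : List (Fin N) → Fin N → Fin N → Option M) :
    ℕ → Finset (Fin N) → List (Fin N) → Fin N → Option M → Fin N → Option M
  | 0, _, path, c, v, i => if c ∈ byz then adv path c i else v
  | k + 1, L, path, c, v, i =>
      majorityVote L fun j =>
        if j = i then (if c ∈ byz then adv path c i else v)
        else omValue byz adv k (L.erase j) (c :: path) j (if c ∈ byz then adv path c j else v) i

/-- Broadcast among `N` participants by `OM(f)`: the sender `s` is the commander and keeps its own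
message, all other participants are lieutenants. -/
def oralMessages (N f : ℕ) : BroadcastSystem N := fun M byz s x out =>
  ∃ adv : List (Fin N) → Fin N → Fin N → Option M, ∀ i,
    out i = if i = s then x else omValue byz adv f (Finset.univ.erase s) [] s x i

namespace Brave

/-! ## Public parameters and messages -/

/-- A deterministic topological sorting procedure, the same for all participants. It gets a finite
set `R` of relationships, where `(a, b) ∈ R` means "`a` is below `b`", and returns a list without
repetitions. If `R` has no cycle, the list consists of the participants that occur in `R`, in an
order that is compatible with `R`. How incomparable participants are arranged and what is returned
for a cyclic `R` is left open. -/
structure TopologicalSort (N : ℕ) where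
  sort : Finset (Fin N × Fin N) → List (Fin N)
  nodup : ∀ R, (sort R).Nodup
  mem_iff : ∀ R, (∀ a, ¬ Relation.TransGen (fun x y => (x, y) ∈ R) a a) →
    ∀ a, a ∈ sort R ↔ ∃ b, (a, b) ∈ R ∨ (b, a) ∈ R
  ordered : ∀ R, (∀ a, ¬ Relation.TransGen (fun x y => (x, y) ∈ R) a a) →
    (sort R).Pairwise fun a b => (b, a) ∉ R

/-- Public parameters: a group of prime order `q` with two generators (for the Pedersen
commitments), the prime modulus `β` of the cloaked values, and the sorting procedure. -/
structure Params (N q : ℕ) (G : Type) [CommGroup G] where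
  prime_q : q.Prime
  card_G : Nat.card G = q
  g : G
  h : G
  g_gen : Subgroup.zpowers g = ⊤
  h_gen : Subgroup.zpowers h = ⊤
  β : ℕ
  prime_β : β.Prime
  tsort : TopologicalSort N

/-- Pedersen commitment to one coordinate. -/
def Params.commit {N q : ℕ} {G : Type} [CommGroup G] (P : Params N q G) (w r : ℤ) : G :=
  P.g ^ w * P.h ^ r

/-- Vectors in `ℤ_q^m`, where `ℤ_q` is the set of non-negative integers that are at most `q`. -/
abbrev Vec (m q : ℕ) : Type := Fin m → Fin (q + 1)

/-- The local model `w` and the private randomness of a participant. -/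
structure PrivateData (N m q : ℕ) where
  w : Vec m q
  r : Vec m q
  v : Fin N → Vec m q
  rv : Fin N → Vec m q
  s1 : Fin N → Vec m q
  rs1 : Fin N → Vec m q
  s2 : Fin N → Vec m q
  rs2 : Fin N → Vec m q

/-- The message `[V_ij, c_ij, r^{w+v}_ij, s¹_ij, r^{s1}_ij, s²_ij, r^{s2}_ij]`. -/
structure MaskMsg (m : ℕ) (G : Type) where
  V : Fin m → G
  c : Fin m → ℤ
  rwv : Fin m → ℤ
  s1 : Fin m → ℤ
  rs1 : Fin m → ℤ
  s2 : Fin m → ℤ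
  rs2 : Fin m → ℤ

/-- The message `m_ij = [d_ij, r^d_ij, V_ij, V_ji]`. -/
structure CmpMsg (m : ℕ) (G : Type) where
  d : Fin m → ℤ
  rd : Fin m → ℤ
  V : Fin m → G
  V' : Fin m → G

/-- The message `(w̄_i, r̄_i, A_i, B_i)` of the last stage. The entries of `w̄_i` and `r̄_i` are
present in the coordinates to which the participant contributes. -/
structure AggMsg (N m : ℕ) (G : Type) where
  wbar : Fin m → Option ℤ
  rbar : Fin m → Option ℤ
  A : Fin N → Fin m → G
  B : Fin N → Fin m → G

/-- Everything that happens in one iteration of the protocol. The first argument of each message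
field is the sender, the last one is the receiver; `none` means that nothing is sent or received.
The fields ending in `In` are the inputs to the broadcast primitive, those ending in `Out` what it
delivers. `cmp p q l` is the message `m_pq` as sent by `p` to `l`.
`relIn l p q` (used for `p < q`) is the set of relationships `R_pq` broadcast by `l`: in coordinate
`k` it says `w_p^k < w_q^k` if the value is `true` and `w_p^k > w_q^k` if it is `false`. -/
structure Transcript (N m q : ℕ) (G : Type) where
  byz : Finset (Fin N)
  priv : Fin N → PrivateData N m q
  commitIn : Fin N → Option (Fin m → G)
  commitOut : Fin N → Fin N → Option (Fin m → G)
  mask : Fin N → Fin N → Option (MaskMsg m G)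
  cmp : Fin N → Fin N → Fin N → Option (CmpMsg m G)
  relIn : Fin N → Fin N → Fin N → Option (Fin m → Bool)
  relOut : Fin N → Fin N → Fin N → Fin N → Option (Fin m → Bool)
  aggIn : Fin N → Option (AggMsg N m G)
  aggOut : Fin N → Fin N → Option (AggMsg N m G)

section Protocol

variable {N m q : ℕ} {G : Type} [CommGroup G]

/-! ## Stage 1: commitment -/

/-- The commitment of participant `i` to its local model. -/
def honestCommit (P : Params N q G) (T : Transcript N m q G) (i : Fin N) : Fin m → G :=
  fun k => P.commit ((T.priv i).w k : ℕ) ((T.priv i).r k : ℕ)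

/-! ## Stage 2: privacy-preserving comparison -/

/-- The masked local model that participant `i` sends to participant `j`. -/
def honestMask (P : Params N q G) (T : Transcript N m q G) (i j : Fin N) : MaskMsg m G where
  V := fun k => P.commit ((T.priv i).v j k : ℕ) ((T.priv i).rv j k : ℕ)
  c := fun k => ((T.priv i).v j k : ℕ) + ((T.priv i).w k : ℕ)
  rwv := fun k => ((T.priv i).r k : ℕ) + ((T.priv i).rv j k : ℕ)
  s1 := fun k => ((T.priv i).s1 j k : ℕ)
  rs1 := fun k => ((T.priv i).rs1 j k : ℕ)
  s2 := fun k => ((T.priv i).s2 j k : ℕ)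
  rs2 := fun k => ((T.priv i).rs2 j k : ℕ)

/-- Participant `i` received the masked model `x` from `j`, and it passes the check
`W_j · V_ji = C(c_ji, r^{w+v}_ji)` in every coordinate. -/
def MaskVerified (P : Params N q G) (T : Transcript N m q G) (i j : Fin N) (x : MaskMsg m G) :
    Prop :=
  T.mask j i = some x ∧ ∃ W, T.commitOut j i = some W ∧
    ∀ k, W k * x.V k = P.commit (x.c k) (x.rwv k)

/-- The message `m_ij` formed by participant `i` from the masked model `x` of `j`. -/
def honestCmp (P : Params N q G) (T : Transcript N m q G) (i j : Fin N) (x : MaskMsg m G) :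
    CmpMsg m G where
  d := fun k => ((T.priv i).v j k : ℕ) + x.c k
  rd := fun k => ((T.priv i).rv j k : ℕ) + x.rwv k
  V := (honestMask P T i j).V
  V' := x.V

/-- `y` is what a benign participant `i` sends as `m_ij`: the message if the check succeeded, and
nothing otherwise. -/
def IsHonestCmp (P : Params N q G) (T : Transcript N m q G) (i j : Fin N)
    (y : Option (CmpMsg m G)) : Prop :=
  (∀ x, MaskVerified P T i j x → y = some (honestCmp P T i j x)) ∧
    ((¬ ∃ x, MaskVerified P T i j x) → y = none)

/-- Participant `l` received `y = m_pq` and `y' = m_qp`, both carry the same `V_pq` and `V_qp`, and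
both open the expected products of commitments. -/
def PairVerified (P : Params N q G) (T : Transcript N m q G) (l p p' : Fin N)
    (y y' : CmpMsg m G) : Prop :=
  T.cmp p p' l = some y ∧ T.cmp p' p l = some y' ∧ y.V = y'.V' ∧ y.V' = y'.V ∧
    ∃ W W', T.commitOut p l = some W ∧ T.commitOut p' l = some W' ∧
      (∀ k, P.commit (y.d k) (y.rd k) = y.V k * y.V' k * W' k) ∧
      (∀ k, P.commit (y'.d k) (y'.rd k) = y'.V k * y'.V' k * W k)

/-- `R` is a possible relationship broadcast of a benign participant `l` on the pair `p, p'`. As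
`d_pp' = v_pp' + v_p'p + w_p'` and `d_p'p = v_p'p + v_pp' + w_p`, the relation between `w_p` and
`w_p'` is that between `d_p'p` and `d_pp'`; ties are broken arbitrarily. A participant does not
compare its own model. -/
def IsHonestRelation (P : Params N q G) (T : Transcript N m q G) (l p p' : Fin N) :
    Option (Fin m → Bool) → Prop
  | none => l = p ∨ l = p' ∨ ¬ ∃ y y', PairVerified P T l p p' y y'
  | some R => l ≠ p ∧ l ≠ p' ∧ ∃ y y', PairVerified P T l p p' y y' ∧
      ∀ k, (R k = true → y'.d k ≤ y.d k) ∧ (R k = false → y.d k ≤ y'.d k)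

/-! ## Stage 3: sorting and trimming -/

/-- Among the relationships delivered to `i`, there is one from `l` that says `w_a^k < w_b^k`. -/
def Claims (T : Transcript N m q G) (i : Fin N) (k : Fin m) (l a b : Fin N) : Prop :=
  (a < b ∧ ∃ R, T.relOut l a b i = some R ∧ R k = true) ∨
    (b < a ∧ ∃ R, T.relOut l b a i = some R ∧ R k = false)

open scoped Classical in
/-- The relationships in coordinate `k` accepted by `i`: those that appear more than `2 f` times. -/
noncomputable def accepted (f : ℕ) (T : Transcript N m q G) (i : Fin N) (k : Fin m) :
    Finset (Fin N × Fin N) :=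
  Finset.univ.filter fun ab =>
    2 * f < (Finset.univ.filter fun l => Claims T i k l ab.1 ab.2).card

/-- The sorting `S_i^k`, in ascending order. -/
noncomputable def sorting (f : ℕ) (P : Params N q G) (T : Transcript N m q G) (i : Fin N)
    (k : Fin m) : List (Fin N) :=
  P.tsort.sort (accepted f T i k)

/-- The contributors `C_i^k`: the `(f+1)`-th to the `(N_i^k - f)`-th entry of `S_i^k`. -/
noncomputable def contributors (f : ℕ) (P : Params N q G) (T : Transcript N m q G) (i : Fin N)
    (k : Fin m) : Finset (Fin N) :=
  (((sorting f P T i k).take ((sorting f P T i k).length - f)).drop f).toFinset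

/-! ## Stage 4: aggregation and verification -/

/-- The contributors that `S_i^k` places below `i`. -/
noncomputable def lowerContributors (f : ℕ) (P : Params N q G) (T : Transcript N m q G)
    (i : Fin N) (k : Fin m) : Finset (Fin N) :=
  (contributors f P T i k).filter fun j =>
    (sorting f P T i k).idxOf j < (sorting f P T i k).idxOf i

/-- The contributors that `S_i^k` places above `i`. -/
noncomputable def upperContributors (f : ℕ) (P : Params N q G) (T : Transcript N m q G)
    (i : Fin N) (k : Fin m) : Finset (Fin N) :=
  (contributors f P T i k).filter fun j =>
    (sorting f P T i k).idxOf i < (sorting f P T i k).idxOf j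

/-- A sum of a value `own` of a participant and a value received from another one, which counts as
`0` if that message is missing. -/
def shared (own : Fin (q + 1)) (msg : Option (MaskMsg m G)) (get : MaskMsg m G → ℤ) : ℤ :=
  (own : ℕ) + (msg.map get).getD 0

/-- The agreed randomness `a_ij`. -/
def padA (T : Transcript N m q G) (i j : Fin N) (k : Fin m) : ℤ :=
  shared ((T.priv i).s1 j k) (T.mask j i) fun x => x.s1 k

/-- The agreed randomness `b_ij`. -/
def padB (T : Transcript N m q G) (i j : Fin N) (k : Fin m) : ℤ :=
  shared ((T.priv i).s2 j k) (T.mask j i) fun x => x.s2 k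

/-- The random helper `r^a_ij`. -/
def helperA (T : Transcript N m q G) (i j : Fin N) (k : Fin m) : ℤ :=
  shared ((T.priv i).rs1 j k) (T.mask j i) fun x => x.rs1 k

/-- The random helper `r^b_ij`. -/
def helperB (T : Transcript N m q G) (i j : Fin N) (k : Fin m) : ℤ :=
  shared ((T.priv i).rs2 j k) (T.mask j i) fun x => x.rs2 k

/-- The cloaked local model and random helper of participant `i` with the commitments to its pads
(the unused pad of `i` with itself is given the commitment `1`). -/
noncomputable def honestAgg (f : ℕ) (P : Params N q G) (T : Transcript N m q G) (i : Fin N) :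
    AggMsg N m G where
  wbar := fun k =>
    if i ∈ contributors f P T i k then
      some ((((T.priv i).w k : ℕ) - ∑ j ∈ lowerContributors f P T i k, padA T i j k
        + ∑ j ∈ upperContributors f P T i k, padA T i j k) % (P.β : ℤ))
    else none
  rbar := fun k =>
    if i ∈ contributors f P T i k then
      some ((((T.priv i).r k : ℕ) - ∑ j ∈ lowerContributors f P T i k, padB T i j k
        + ∑ j ∈ upperContributors f P T i k, padB T i j k) % (P.β : ℤ))
    else none
  A := fun j k => if j = i then 1 else P.commit (padA T i j k) (helperA T i j k)
  B := fun j k => if j = i then 1 else P.commit (padB T i j k) (helperB T i j k)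

/-- The cloaked value `w̄_j^k` as delivered to `i`. -/
def cloakedModel (T : Transcript N m q G) (i j : Fin N) (k : Fin m) : Option ℤ :=
  (T.aggOut j i).bind fun y => y.wbar k

/-- The cloaked helper `r̄_j^k` as delivered to `i`. -/
def cloakedHelper (T : Transcript N m q G) (i j : Fin N) (k : Fin m) : Option ℤ :=
  (T.aggOut j i).bind fun y => y.rbar k

/-- The commitment `W_j^k` as delivered to `i`. -/
def commitment (T : Transcript N m q G) (i j : Fin N) (k : Fin m) : Option G :=
  (T.commitOut j i).map fun W => W k

/-- The sum `w̄^k` computed by `i`. -/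
noncomputable def cloakedSum (f : ℕ) (P : Params N q G) (T : Transcript N m q G) (i : Fin N)
    (k : Fin m) : ℤ :=
  (∑ j ∈ contributors f P T i k, (cloakedModel T i j k).getD 0) % (P.β : ℤ)

/-- The sum `r̄^k` computed by `i`. -/
noncomputable def helperSum (f : ℕ) (P : Params N q G) (T : Transcript N m q G) (i : Fin N)
    (k : Fin m) : ℤ :=
  (∑ j ∈ contributors f P T i k, (cloakedHelper T i j k).getD 0) % (P.β : ℤ)

/-- Participant `i` accepts the aggregation in coordinate `k`: it has contributors
(that is, `2 f < N_i^k`), none of the required values is missing, and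
`C(w̄^k, r̄^k) = ∏ W_j^k` over the contributors `j`. -/
def AggVerified (f : ℕ) (P : Params N q G) (T : Transcript N m q G) (i : Fin N) (k : Fin m) :
    Prop :=
  2 * f < (sorting f P T i k).length ∧
  (∀ j ∈ contributors f P T i k, (cloakedModel T i j k).isSome ∧
    (cloakedHelper T i j k).isSome ∧ (commitment T i j k).isSome) ∧
  P.commit (cloakedSum f P T i k) (helperSum f P T i k) =
    ∏ j ∈ contributors f P T i k, (commitment T i j k).getD 1

open scoped Classical in
/-- The global model computed by participant `i`: coordinate `k` is `w̄^k / (N_i^k - 2 f)` if the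
verification succeeds, and is not computed (`none`) otherwise. -/
noncomputable def globalModel (f : ℕ) (P : Params N q G) (T : Transcript N m q G) (i : Fin N) :
    Fin m → Option ℚ := fun k =>
  if AggVerified f P T i k then
    some ((cloakedSum f P T i k : ℚ) / (((sorting f P T i k).length : ℚ) - 2 * (f : ℚ)))
  else none

/-! ## Executions -/

/-- `T` is a possible iteration of the protocol over the broadcast primitive `B`, with at most `f`
Byzantine participants. All other participants follow the protocol. Byzantine ones broadcast and
send (or do not send) whatever they like, possibly different messages to different participants.
Point-to-point messages are delivered as sent. -/
structure IsExecution (B : BroadcastSystem N) (f : ℕ) (P : Params N q G)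
    (T : Transcript N m q G) : Prop where
  byz_card : T.byz.card ≤ f
  commit_honest : ∀ i ∉ T.byz, T.commitIn i = some (honestCommit P T i)
  commit_broadcast : ∀ i, B (Fin m → G) T.byz i (T.commitIn i) (T.commitOut i)
  mask_honest : ∀ i ∉ T.byz, ∀ j, j ≠ i → T.mask i j = some (honestMask P T i j)
  cmp_honest : ∀ i ∉ T.byz, ∀ j, j ≠ i → ∀ l, l ≠ j → IsHonestCmp P T i j (T.cmp i j l)
  rel_honest : ∀ l ∉ T.byz, ∀ p p', p < p' → IsHonestRelation P T l p p' (T.relIn l p p')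
  rel_broadcast : ∀ l p p', p < p' →
    B (Fin m → Bool) T.byz l (T.relIn l p p') (T.relOut l p p')
  agg_honest : ∀ i ∉ T.byz, T.aggIn i = some (honestAgg f P T i)
  agg_broadcast : ∀ i, B (AggMsg N m G) T.byz i (T.aggIn i) (T.aggOut i)

end Protocol

end Brave

/-!
A benign participant computes the global model from its deliveries of the broadcasts alone: the
commitments, the relationships and the cloaked values. Point-to-point messages, in which a Byzantine
participant may be inconsistent, influence only what is fed into the broadcasts. As a BFT broadcast
delivers the same message to all benign participants, and as the sorting procedure is common to all
of them, the accepted relationships, the sortings, the contributors and the outcome of the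
verification agree (`Brave.globalModel_congr`).

It remains to see that `OM(f)` is a BFT broadcast (`isBFTBroadcast_oralMessages`), which is the
theorem of Lamport, Shostak and Pease. Its proof is by two inductions on the depth of the recursion.
With `t` traitors among the lieutenants, `OM(k)` transmits the order of a loyal commander as soon as
there are `2 t + k` lieutenants (`omValue_eq_of_commander_loyal`): the loyal lieutenants are a
majority and are relayed faithfully. If there are `3 k` lieutenants and `k` traitors including the
commander, all loyal lieutenants settle on the same value (`omValue_agree`): a treacherous commander
leaves at most `k - 1` traitors among the lieutenants, so by induction the loyal lieutenants vote on
the same list of relayed values.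
-/

/-! ### The majority vote -/

theorem majorityVote_congr {N : ℕ} {M : Type} {L : Finset (Fin N)} {val val' : Fin N → Option M}
    (h : ∀ j ∈ L, val j = val' j) : majorityVote L val = majorityVote L val' := by
  classical
  have key : ∀ x, (L.filter fun j => val j = x) = L.filter fun j => val' j = x := fun x =>
    Finset.filter_congr fun j hj => by rw [h j hj]
  unfold majorityVote
  simp only [key]

theorem majorityVote_eq {N : ℕ} {M : Type} {L S : Finset (Fin N)} {val : Fin N → Option M}
    {x : Option M} (hS : S ⊆ L) (hcard : L.card < 2 * S.card) (hval : ∀ j ∈ S, val j = x) :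
    majorityVote L val = x := by
  classical
  have hx : L.card < 2 * (L.filter fun j => val j = x).card := by
    have : S.card ≤ (L.filter fun j => val j = x).card :=
      Finset.card_le_card fun j hj => Finset.mem_filter.2 ⟨hS hj, hval j hj⟩
    omega
  have hex : ∃ y, L.card < 2 * (L.filter fun j => val j = y).card := ⟨x, hx⟩
  have hmaj : majorityVote L val = hex.choose := by
    unfold majorityVote
    convert dif_pos hex
  have hy : L.card < 2 * (L.filter fun j => val j = hex.choose).card := hex.choose_spec
  rw [hmaj]
  by_contra hne
  -- Two different values cannot both have a strict majority.
  have hdisj : Disjoint (L.filter fun j => val j = hex.choose) (L.filter fun j => val j = x) :=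
    Finset.disjoint_filter.2 fun j _ h1 h2 => hne (h1.symm.trans h2)
  have hle := Finset.card_le_card
    (Finset.union_subset (Finset.filter_subset (fun j => val j = hex.choose) L)
      (Finset.filter_subset (fun j => val j = x) L))
  rw [Finset.card_union_of_disjoint hdisj] at hle
  omega

/-! ### The oral messages algorithm -/

section OralMessages

variable {N : ℕ} {M : Type} {byz : Finset (Fin N)}
  {adv : List (Fin N) → Fin N → Fin N → Option M}

/-- Validity of `OM(k)`. The bound on the number of lieutenants involves the number of traitors
among them, which need not be `k`; this keeps the statement inductive, as it loses one lieutenant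
and no traitor when a loyal lieutenant relays. The value at a treacherous lieutenant `i` is the one
that the algorithm would yield from the messages `i` receives, so `i` need not be loyal. -/
theorem omValue_eq_of_commander_loyal (k : ℕ) {L : Finset (Fin N)} (path : List (Fin N))
    {c : Fin N} (v : Option M) {i : Fin N} (hc : c ∉ byz)
    (hL : 2 * (L ∩ byz).card + k ≤ L.card) (hi : i ∈ L) :
    omValue byz adv k L path c v i = v := by
  induction k generalizing L path c v with
  | zero => simp [omValue, hc]
  | succ k ih =>
    rw [omValue]
    refine majorityVote_eq (S := L \ byz) Finset.sdiff_subset ?_ ?_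
    · have := Finset.card_sdiff_add_card_inter L byz
      omega
    · intro j hj
      obtain ⟨hjL, hjb⟩ := Finset.mem_sdiff.1 hj
      simp only [hc, if_false]
      split_ifs with hji
      · rfl
      · have h1 := Finset.card_erase_of_mem hjL
        have h2 : (L.erase j ∩ byz).card ≤ (L ∩ byz).card :=
          Finset.card_le_card (Finset.inter_subset_inter_right (Finset.erase_subset _ _))
        exact ih (c :: path) v hjb (by omega) (Finset.mem_erase.2 ⟨Ne.symm hji, hi⟩)

/-- Agreement of `OM(k)`. The traitors are counted among all generals, including the commander. -/
theorem omValue_agree (k : ℕ) {L : Finset (Fin N)} (path : List (Fin N)) {c : Fin N}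
    (v : Option M) {i i' : Fin N} (hcL : c ∉ L) (hL : 3 * k ≤ L.card)
    (hb : (insert c L ∩ byz).card ≤ k) (hi : i ∈ L) (hib : i ∉ byz)
    (hi' : i' ∈ L) (hib' : i' ∉ byz) :
    omValue byz adv k L path c v i = omValue byz adv k L path c v i' := by
  induction k generalizing L path c v with
  | zero =>
    have hc : c ∉ byz := fun hc => by
      have := Finset.card_pos.2 ⟨c, Finset.mem_inter.2 ⟨Finset.mem_insert_self c L, hc⟩⟩
      omega
    simp [omValue, hc]
  | succ k ih =>
    by_cases hc : c ∈ byz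
    · have ht : (L ∩ byz).card ≤ k := by
        rw [Finset.insert_inter_of_mem hc,
          Finset.card_insert_of_notMem fun h => hcL (Finset.mem_inter.1 h).1] at hb
        omega
      -- A loyal lieutenant is relayed faithfully, so the value that it uses directly is the one
      -- that the other loyal lieutenants receive from it.
      have relay : ∀ a ∈ L, a ∉ byz → ∀ b ∈ L, b ≠ a → ∀ u,
          omValue byz adv k (L.erase a) (c :: path) a u b = u := by
        intro a ha hab b hbL hne u
        have h1 := Finset.card_erase_of_mem ha
        have h2 : (L.erase a ∩ byz).card ≤ (L ∩ byz).card :=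
          Finset.card_le_card (Finset.inter_subset_inter_right (Finset.erase_subset _ _))
        exact omValue_eq_of_commander_loyal k _ u hab (by omega)
          (Finset.mem_erase.2 ⟨hne, hbL⟩)
      rw [omValue, omValue]
      refine majorityVote_congr fun j hj => ?_
      simp only [hc, if_true]
      split_ifs with h1 h2 h2
      · rw [← h1, ← h2]
      · subst h1
        exact (relay j hj hib i' hi' (Ne.symm h2) _).symm
      · subst h2
        exact relay j hj hib' i hi (Ne.symm h1) _
      · have := Finset.card_erase_of_mem hj
        refine ih (c :: path) _ (Finset.notMem_erase j L) (by omega) ?_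
          (Finset.mem_erase.2 ⟨Ne.symm h1, hi⟩) (Finset.mem_erase.2 ⟨Ne.symm h2, hi'⟩)
        rwa [Finset.insert_erase hj]
    · rw [Finset.insert_inter_of_notMem hc] at hb
      rw [omValue_eq_of_commander_loyal (k + 1) path v hc (by omega) hi,
        omValue_eq_of_commander_loyal (k + 1) path v hc (by omega) hi']

end OralMessages

theorem isBFTBroadcast_oralMessages (N f : ℕ) : IsBFTBroadcast f (oralMessages N f) := by
  intro hN M byz hbyz s x
  have hcard : (Finset.univ.erase s).card = N - 1 := by
    rw [Finset.card_erase_of_mem (Finset.mem_univ s), Finset.card_univ, Fintype.card_fin]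
  have hle (L : Finset (Fin N)) : (L ∩ byz).card ≤ f :=
    (Finset.card_le_card Finset.inter_subset_right).trans hbyz
  refine ⟨⟨_, fun _ _ _ => none, fun _ => rfl⟩, ?_⟩
  rintro out ⟨adv, hout⟩
  have valid : s ∉ byz → ∀ i ∉ byz, out i = x := by
    intro hs i hi
    rw [hout i]
    split_ifs with his
    · rfl
    · have := hle (Finset.univ.erase s)
      exact omValue_eq_of_commander_loyal f [] x hs (by omega) (by simp [his])
  refine ⟨fun i hi j hj => ?_, valid⟩
  by_cases hs : s ∈ byz
  · have his : i ≠ s := fun h => hi (h ▸ hs)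
    have hjs : j ≠ s := fun h => hj (h ▸ hs)
    rw [hout i, hout j, if_neg his, if_neg hjs]
    exact omValue_agree f [] x (Finset.notMem_erase s _) (by omega) (hle _)
      (by simp [his]) hi (by simp [hjs]) hj
  · rw [valid hs i hi, valid hs j hj]

/-! ### The global model as a function of the delivered broadcasts -/

namespace Brave

variable {N m q : ℕ} {G : Type}

theorem claims_congr {T : Transcript N m q G} {i j : Fin N}
    (hrel : ∀ l p p', p < p' → T.relOut l p p' i = T.relOut l p p' j) (k : Fin m)
    (l a b : Fin N) : Claims T i k l a b ↔ Claims T j k l a b := by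
  unfold Claims
  refine or_congr (and_congr_right fun h => ?_) (and_congr_right fun h => ?_) <;>
    rw [hrel l _ _ h]

theorem accepted_congr (f : ℕ) {T : Transcript N m q G} {i j : Fin N}
    (hrel : ∀ l p p', p < p' → T.relOut l p p' i = T.relOut l p p' j) (k : Fin m) :
    accepted f T i k = accepted f T j k := by
  classical
  ext ab
  have key : (Finset.univ.filter fun l => Claims T i k l ab.1 ab.2) =
      Finset.univ.filter fun l => Claims T j k l ab.1 ab.2 :=
    Finset.filter_congr fun l _ => claims_congr hrel k l ab.1 ab.2
  simp only [accepted, Finset.mem_filter, Finset.mem_univ, true_and]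
  convert Iff.rfl using 3
  convert key.symm using 2

variable [CommGroup G]

/-- Participants to whom the broadcasts deliver the same messages compute the same global model. -/
theorem globalModel_congr (f : ℕ) (P : Params N q G) {T : Transcript N m q G} {i j : Fin N}
    (hcommit : ∀ l, T.commitOut l i = T.commitOut l j)
    (hrel : ∀ l p p', p < p' → T.relOut l p p' i = T.relOut l p p' j)
    (hagg : ∀ l, T.aggOut l i = T.aggOut l j) :
    globalModel f P T i = globalModel f P T j := by
  funext k
  have hsort : sorting f P T i k = sorting f P T j k := by
    unfold sorting
    rw [accepted_congr f hrel]
  have hcontr : contributors f P T i k = contributors f P T j k := by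
    unfold contributors
    rw [hsort]
  have hmodel : ∀ l, cloakedModel T i l k = cloakedModel T j l k := fun l => by
    unfold cloakedModel
    rw [hagg]
  have hhelper : ∀ l, cloakedHelper T i l k = cloakedHelper T j l k := fun l => by
    unfold cloakedHelper
    rw [hagg]
  have hcom : ∀ l, commitment T i l k = commitment T j l k := fun l => by
    unfold commitment
    rw [hcommit]
  have hsum : cloakedSum f P T i k = cloakedSum f P T j k := by
    simp only [cloakedSum, hcontr, hmodel]
  have hhsum : helperSum f P T i k = helperSum f P T j k := by
    simp only [helperSum, hcontr, hhelper]
  have hver : AggVerified f P T i k ↔ AggVerified f P T j k := by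
    simp only [AggVerified, hsort, hcontr, hmodel, hhelper, hcom, hsum, hhsum]
  unfold globalModel
  by_cases h : AggVerified f P T j k
  · rw [if_pos h, if_pos (hver.2 h), hsum, hsort]
  · rw [if_neg h, if_neg (mt hver.1 h)]

theorem IsExecution.globalModel_agree {B : BroadcastSystem N} {f : ℕ} {P : Params N q G}
    {T : Transcript N m q G} (hT : IsExecution B f P T) (hN : 3 * f < N)
    (hB : IsBFTBroadcast f B) {i j : Fin N} (hi : i ∉ T.byz) (hj : j ∉ T.byz) :
    globalModel f P T i = globalModel f P T j := by
  have agree : ∀ {M : Type} {s : Fin N} {x : Option M} {out : Fin N → Option M},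
      B M T.byz s x out → out i = out j := fun h =>
    ((hB hN _ T.byz hT.byz_card _ _).2 _ h).1 i hi j hj
  exact globalModel_congr f P (fun l => agree (hT.commit_broadcast l))
    (fun l p p' h => agree (hT.rel_broadcast l p p' h)) fun l => agree (hT.agg_broadcast l)

end Brave

theorem mainTheorem3 {N f m q : ℕ} {G : Type} [CommGroup G] (hN : 3 * f + 2 < N)
    (P : Brave.Params N q G) :
    (∀ T : Brave.Transcript N m q G, Brave.IsExecution (oralMessages N f) f P T →
      ∀ i ∉ T.byz, ∀ j ∉ T.byz, Brave.globalModel f P T i = Brave.globalModel f P T j) ∧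
    (∀ B : BroadcastSystem N, IsBFTBroadcast f B →
      ∀ T : Brave.Transcript N m q G, Brave.IsExecution B f P T →
        ∀ i ∉ T.byz, ∀ j ∉ T.byz, Brave.globalModel f P T i = Brave.globalModel f P T j) := by
  have hN' : 3 * f < N := by omega
  exact ⟨fun _ hT _ hi _ hj => hT.globalModel_agree hN' (isBFTBroadcast_oralMessages N f) hi hj,
    fun _ hB _ hT _ hi _ hj => hT.globalModel_agree hN' hB hi hj⟩
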